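/- Let $\Lambda \ge 0$ be an integer. A (finite, simple, undirected) edge-colored graph $G=(V,E,c)$ has an arbitrary coloring $c:E\to[\Lambda]=\{1,\dots,\Lambda\}$ of its edges; isomorphisms of edge-colored graphs are graph isomorphisms that preserve the color of every edge. For $v\in V$ let $G_v$ be the edge-colored graph obtained from $G$ by deleting $v$ and all edges incident with $v$ and restricting $c$ to the remaining edges. Two edge-colored graphs $G$ and $H$ with the same vertex set $V$ are reconstructions of each other if $G_v\cong H_v$ for every $v\in V$. The colored $U$-polynomial of $G$ is $$U_{lab}(G;\bar x,\bar y)=\sum_{A\subseteq E}\ \prod_{e\in A}y_{c(e)}\ \prod_{D}x_{|V(D)|}\ \in\ \mathbb{Z}[x_1,x_2,\dots;\,y_1,\dots,y_\Lambda],$$ where $D$ runs over the connected components of the spanning subgraph $(V,A)$. **Theorem.** The polynomial $U_{lab}$ is reconstructible: it is invariant under isomorphism of edge-colored graphs, and if $G$ and $H$ are edge-colored graphs on the same vertex set with at least three vertices that are reconstructions of each other, then $U_{lab}(G;\bar x,\bar y)=U_{lab}(H;\bar x,\bar y)$. -/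

import Mathlib

universe u

/-- A simple undirected graph on the vertex set `V` together with a (not necessarily proper)
coloring of its edges by elements of `C`. -/
structure EdgeColoredGraph (V : Type u) (C : Type) where
  /-- the underlying simple graph -/
  graph : SimpleGraph V
  /-- the coloring of the edges -/
  color : graph.edgeSet → C

namespace EdgeColoredGraph

/-- Isomorphism of edge-colored graphs: a graph isomorphism that preserves the color of
every edge. -/
def IsIsomorphic {V W : Type u} {C : Type} (G : EdgeColoredGraph V C)
    (H : EdgeColoredGraph W C) : Prop :=
  ∃ φ : G.graph ≃g H.graph, ∀ e : G.graph.edgeSet, H.color (φ.mapEdgeSet e) = G.color e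

/-- The edge-colored subgraph induced by the set `s` of vertices. -/
def induce {V : Type u} {C : Type} (G : EdgeColoredGraph V C) (s : Set V) :
    EdgeColoredGraph s C where
  graph := G.graph.induce s
  color := fun e => G.color ((SimpleGraph.Embedding.induce s).mapEdgeSet e)

/-- The vertex-deleted subgraph `G_v`: delete `v` and all its incident edges, and restrict the
coloring. -/
def deleteVertex {V : Type u} {C : Type} (G : EdgeColoredGraph V C) (v : V) :
    EdgeColoredGraph ({v}ᶜ : Set V) C :=
  G.induce {v}ᶜ

/-- `H` is a reconstruction of `G`: they have the same vertex set, and `G_v` and `H_v` are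
isomorphic as edge-colored graphs for every vertex `v`. -/
def IsReconstruction {V : Type u} {C : Type} (G H : EdgeColoredGraph V C) : Prop :=
  ∀ v : V, (G.deleteVertex v).IsIsomorphic (H.deleteVertex v)

/-- The spanning subgraph `(V, A)` for a set `A` of edges of `G`. -/
def spanningSubgraph {V : Type u} {C : Type} (G : EdgeColoredGraph V C)
    (A : Set G.graph.edgeSet) : SimpleGraph V :=
  SimpleGraph.fromEdgeSet ((fun e : G.graph.edgeSet => (e : Sym2 V)) '' A)

open Classical in
/-- The colored `U`-polynomial, a polynomial with integer coefficients in the variables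
`x_i` (the variable `Sum.inl i`, for `i : ℕ`) and `y_c` (the variable `Sum.inr c`, for a color
`c`): the sum over all sets `A` of edges of the product of `y_{c(e)}` over `e ∈ A`, times the
product of `x_{|V(D)|}` over the connected components `D` of `(V, A)`. -/
noncomputable def Ulab {V : Type u} [Fintype V] {C : Type} (G : EdgeColoredGraph V C) :
    MvPolynomial (ℕ ⊕ C) ℤ :=
  ∑ A : Finset G.graph.edgeSet,
    (∏ e ∈ A, MvPolynomial.X (Sum.inr (G.color e))) *
      ∏ D : (G.spanningSubgraph (A : Set G.graph.edgeSet)).ConnectedComponent,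
        MvPolynomial.X (Sum.inl D.supp.ncard)

/-- A function of finite edge-colored graphs (with colors in `C`) is a graph invariant if it takes
the same value on isomorphic graphs. -/
def IsGraphInvariant {C R : Type}
    (μ : ∀ (V : Type u) [Fintype V], EdgeColoredGraph V C → R) : Prop :=
  ∀ (V W : Type u) [Fintype V] [Fintype W] (G : EdgeColoredGraph V C)
    (H : EdgeColoredGraph W C), G.IsIsomorphic H → μ V G = μ W H

/-- A function of finite edge-colored graphs is reconstructible if it is a graph invariant and
takes the same value on any two graphs with at least three vertices that are reconstructions of
each other. -/
def IsReconstructible {C R : Type}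
    (μ : ∀ (V : Type u) [Fintype V], EdgeColoredGraph V C → R) : Prop :=
  IsGraphInvariant μ ∧
    ∀ (V : Type u) [Fintype V], 3 ≤ Fintype.card V →
      ∀ G H : EdgeColoredGraph V C, G.IsReconstruction H → μ V G = μ V H

end EdgeColoredGraph

/-!
The proof evaluates the polynomial at points where its dependence on connected components
disappears, and compares the values by the lemmas of Kelly and Kocay.

Substitute for `x_k` a power sum `∑ i, z i ^ k` over a finite index set `ι`. The product of the
`x_{|V(D)|}` over the components `D` of `(V, A)` becomes the sum of `∏ v, z (κ v)` over the maps
`κ : V → ι` that are constant on the components, that is, along the edges in `A`. Exchanging the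
two sums turns the value of the polynomial into
`∑ κ, ∏ i, z i ^ |κ⁻¹ i| * P (κ⁻¹ i)`, where `P S` is the product of `1 + y_{c(e)}` over the edges
`e` inside `S` (`eval_Ulab_powerSum`). This is an iterated subset convolution of the set functions
`z i ^ |S| * P S` (`partSum_insert`), so that it suffices to follow convolutions of two set
functions.

Kelly's lemma (`Hypomorphic.sum_ne_univ`): the sum of a set function over the proper subsets
of `V` depends only on the isomorphism classes of its restrictions to the sets `V \ {v}`. Kocay's
argument (`Hypomorphic.sum_mul_compl`) derives the same for `∑ f S * f' (V \ S)` over the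
splittings of `V` into two nonempty parts: the sum over all pairs of sets of sizes `k` and
`|V| - k` is a product of two sums controlled by Kelly's lemma, the pairs whose union is a proper
subset are controlled by it as well, and the remaining pairs are the splittings. The terms of the
convolution in which one part is empty involve the values at `V` of the two factors. One of them is
known by induction on the number of factors. The other one contains `P V`, whose power with exponent
`|V| - 2` is the product of the `P (V \ {v})`; for nonnegative `y` this determines `P V`
(`edgeProd_univ_eq`).

Finally, these points suffice to determine the polynomial (`Ulab_eq_of_mapSum_eq`). The power sums
of the numbers `0, …, n`, each repeated `m i` times, are linear in the multiplicities `m`. An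
identity between polynomials in `m` and `y` valid at all natural numbers is a formal one, and by
invertibility of the Vandermonde matrix rational multiplicities reach all values of
`x_0, …, x_n`.
-/

open Finset

namespace EdgeColoredGraph

/-! ### Set functions and the lemmas of Kelly and Kocay -/

section SetFunction

variable {V W : Type u}

/-- The bijection `φ` carries the set function `f` to the set function `g`, as far as the
subsets of `U` are concerned. -/
def Agree (φ : V ≃ W) (U : Finset V) (f : Finset V → ℚ) (g : Finset W → ℚ) : Prop :=
  ∀ S ⊆ U, g (S.map φ.toEmbedding) = f S

/-- The restriction of a set function to the sets with `k` elements, extended by zero. -/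
def cardPart (k : ℕ) (f : Finset V → ℚ) (S : Finset V) : ℚ :=
  if #S = k then f S else 0

lemma Agree.cardPart {φ : V ≃ W} {U : Finset V} {f : Finset V → ℚ} {g : Finset W → ℚ}
    (h : Agree φ U f g) (k : ℕ) : Agree φ U (cardPart k f) (cardPart k g) := by
  intro S hS
  simp [EdgeColoredGraph.cardPart, h S hS]

variable [DecidableEq V] [DecidableEq W]

/-- The subset convolution of two set functions: the sum over all splittings of `S` into two
disjoint, possibly empty, parts. -/
def subsetConv (f f' : Finset V → ℚ) (S : Finset V) : ℚ :=
  ∑ T ∈ S.powerset, f T * f' (S \ T)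

lemma Agree.subsetConv {φ : V ≃ W} {U : Finset V} {f f' : Finset V → ℚ} {g g' : Finset W → ℚ}
    (h : Agree φ U f g) (h' : Agree φ U f' g') :
    Agree φ U (subsetConv f f') (subsetConv g g') := by
  intro S hS
  symm
  refine Finset.sum_equiv φ.finsetCongr (fun T => ?_) (fun T hT => ?_)
  · simp
  · have hT' := Finset.mem_powerset.1 hT
    rw [Equiv.finsetCongr_apply, h T (hT'.trans hS), ← Finset.map_sdiff,
      h' _ (Finset.sdiff_subset.trans hS)]

variable [Fintype V] [Fintype W]

/-- The union product of two set functions: the sum over all pairs of sets, overlapping or not,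
with union `S`. -/
def unionProd (f f' : Finset V → ℚ) (S : Finset V) : ℚ :=
  ∑ p : Finset V × Finset V with p.1 ∪ p.2 = S, f p.1 * f' p.2

lemma Agree.unionProd {φ : V ≃ W} {U : Finset V} {f f' : Finset V → ℚ} {g g' : Finset W → ℚ}
    (h : Agree φ U f g) (h' : Agree φ U f' g') :
    Agree φ U (unionProd f f') (unionProd g g') := by
  intro S hS
  symm
  refine Finset.sum_equiv (φ.finsetCongr.prodCongr φ.finsetCongr) (fun p => ?_) (fun p hp => ?_)
  · simp [← Finset.map_union]
  · have hp' : p.1 ∪ p.2 = S := by simpa using hp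
    have h1 : p.1 ⊆ U := (Finset.subset_union_left.trans hp'.le).trans hS
    have h2 : p.2 ⊆ U := (Finset.subset_union_right.trans hp'.le).trans hS
    simp [h _ h1, h' _ h2]

/-- The set functions `f` and `g` become isomorphic after the deletion of any one point; `σ v` is
the isomorphism witnessing this for the point `v`. -/
def Hypomorphic (σ : V → Equiv.Perm V) (f g : Finset V → ℚ) : Prop :=
  ∀ v, Agree (σ v) {v}ᶜ f g

/-- Double counting: the proper subset `S` is counted once for each of the `|V| - |S|` points
outside it. -/
lemma sum_ne_univ_eq (f : Finset V → ℚ) :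
    ∑ S : Finset V with S ≠ univ, f S =
      ∑ v, ∑ S : Finset V with v ∉ S, f S / ((Fintype.card V : ℚ) - #S) := by
  rw [Finset.sum_comm' (t' := univ.filter (fun S : Finset V => S ≠ univ)) (s' := fun S => Sᶜ)]
  · refine Finset.sum_congr rfl fun S hS => ?_
    obtain ⟨x, hx⟩ : ∃ x, x ∉ S := by
      simpa [eq_univ_iff_forall] using hS
    have hlt : #S < Fintype.card V := Finset.card_lt_univ_of_notMem hx
    rw [Finset.sum_const, Finset.card_compl, nsmul_eq_mul, Nat.cast_sub hlt.le, mul_div_cancel₀]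
    have : (#S : ℚ) < Fintype.card V := by exact_mod_cast hlt
    linarith
  · intro v S
    simp only [mem_univ, mem_filter, true_and, mem_compl, ne_eq]
    exact ⟨fun h => ⟨h, fun h' => h (h' ▸ mem_univ v)⟩, fun h => h.1⟩

/-- Kelly's lemma, for all proper subsets at once. -/
lemma Hypomorphic.sum_ne_univ {σ : V → Equiv.Perm V} (hσ : ∀ v, σ v v = v)
    {f g : Finset V → ℚ} (h : Hypomorphic σ f g) :
    ∑ S : Finset V with S ≠ univ, f S = ∑ S : Finset V with S ≠ univ, g S := by
  rw [sum_ne_univ_eq, sum_ne_univ_eq]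
  refine Finset.sum_congr rfl fun v _ => ?_
  refine Finset.sum_equiv (σ v).finsetCongr (fun S => ?_) (fun S hS => ?_)
  · have hv : (σ v).symm v = v := by rw [Equiv.symm_apply_eq, hσ]
    simp [Finset.mem_map_equiv, hv]
  · have hS' : S ⊆ {v}ᶜ := by simpa using hS
    rw [Equiv.finsetCongr_apply, h v S hS', Finset.card_map]

lemma sum_cardPart_eq {k : ℕ} (hk : k < Fintype.card V) (f : Finset V → ℚ) :
    ∑ S, cardPart k f S = ∑ S : Finset V with S ≠ univ, cardPart k f S := by
  refine (Finset.sum_filter_of_ne fun S _ hS => ?_).symm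
  rintro rfl
  apply hS
  rw [cardPart, Finset.card_univ, if_neg hk.ne']

lemma sum_unionProd (f f' : Finset V → ℚ) :
    ∑ S, unionProd f f' S = (∑ S, f S) * ∑ S, f' S := by
  unfold unionProd
  rw [Finset.sum_fiberwise, Finset.sum_mul_sum, Fintype.sum_prod_type]

/-- Two sets whose sizes add up to `|V|` cover `V` exactly when they are complementary. -/
lemma unionProd_cardPart_univ (k : ℕ) (f f' : Finset V → ℚ) :
    unionProd (cardPart k f) (cardPart (Fintype.card V - k) f') univ =
      ∑ T : Finset V, cardPart k f T * f' Tᶜ := by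
  unfold unionProd
  have key : ∀ p : Finset V × Finset V, p.1 ∪ p.2 = univ →
      cardPart k f p.1 * cardPart (Fintype.card V - k) f' p.2 ≠ 0 → p.2 = p.1ᶜ := by
    intro p hp hne
    have h1 : #p.1 = k := by
      by_contra h; simp [cardPart, h] at hne
    have h2 : #p.2 = Fintype.card V - k := by
      by_contra h; simp [cardPart, h] at hne
    symm
    apply Finset.eq_of_subset_of_card_le
    · intro x hx
      have : x ∈ p.1 ∪ p.2 := hp ▸ mem_univ x
      rcases Finset.mem_union.1 this with h | h
      · exact absurd h (Finset.mem_compl.1 hx)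
      · exact h
    · rw [Finset.card_compl, h1, h2]
  rw [Finset.sum_filter, Fintype.sum_prod_type]
  refine Finset.sum_congr rfl fun T _ => ?_
  rw [Finset.sum_eq_single Tᶜ]
  · simp only [Finset.union_compl, if_true]
    by_cases hT : #T = k
    · simp [cardPart, Finset.card_compl, hT]
    · simp [cardPart, hT]
  · intro T' _ hT'
    split_ifs with hu
    · by_contra hne
      exact hT' (key (T, T') hu hne)
    · rfl
  · simp

/-- Kocay's lemma for two sets: the sum over the splittings of the whole vertex set into two
nonempty parts agrees for hypomorphic set functions, since the sum over all pairs of proper subsets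
of given sizes factors, and the pairs not covering the vertex set are controlled by Kelly's
lemma. -/
lemma Hypomorphic.sum_mul_compl {σ : V → Equiv.Perm V} (hσ : ∀ v, σ v v = v)
    {f g f' g' : Finset V → ℚ} (h : Hypomorphic σ f g) (h' : Hypomorphic σ f' g') :
    ∑ T : Finset V with T ≠ ∅ ∧ T ≠ univ, f T * f' Tᶜ =
      ∑ T : Finset V with T ≠ ∅ ∧ T ≠ univ, g T * g' Tᶜ := by
  have split : ∀ f f' : Finset V → ℚ, ∑ T : Finset V with T ≠ ∅ ∧ T ≠ univ, f T * f' Tᶜ =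
      ∑ k ∈ Ioo 0 (Fintype.card V), ∑ T : Finset V, cardPart k f T * f' Tᶜ := by
    intro f f'
    rw [Finset.sum_comm, Finset.sum_filter]
    refine Finset.sum_congr rfl fun T _ => ?_
    have e1 : (T ≠ ∅ ∧ T ≠ univ) ↔ #T ∈ Ioo 0 (Fintype.card V) := by
      rw [mem_Ioo, Finset.card_pos, Finset.nonempty_iff_ne_empty, ← not_iff_not]
      have := Finset.card_le_univ T
      have := Finset.card_eq_iff_eq_univ T
      grind
    simp only [e1, cardPart, ite_mul, zero_mul, Finset.sum_ite_eq]
  rw [split, split]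
  refine Finset.sum_congr rfl fun k hk => ?_
  obtain ⟨hk0, hk1⟩ := mem_Ioo.1 hk
  rw [← unionProd_cardPart_univ, ← unionProd_cardPart_univ]
  have e1 := Hypomorphic.sum_ne_univ hσ (fun v => (h v).cardPart k)
  have e2 := Hypomorphic.sum_ne_univ hσ (fun v => (h' v).cardPart (Fintype.card V - k))
  have e3 := Hypomorphic.sum_ne_univ hσ
    (fun v => ((h v).cardPart k).unionProd ((h' v).cardPart (Fintype.card V - k)))
  have hk2 : Fintype.card V - k < Fintype.card V := by omega
  rw [← sum_cardPart_eq hk1, ← sum_cardPart_eq hk1] at e1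
  rw [← sum_cardPart_eq hk2, ← sum_cardPart_eq hk2] at e2
  have tot : ∀ F : Finset V → ℚ, ∑ S, F S = F univ + ∑ S : Finset V with S ≠ univ, F S := by
    intro F
    rw [← Finset.sum_filter_add_sum_filter_not univ (fun S => S = univ), Finset.filter_eq']
    simp
  have e4 := tot (EdgeColoredGraph.unionProd (EdgeColoredGraph.cardPart k f)
    (EdgeColoredGraph.cardPart (Fintype.card V - k) f'))
  have e5 := tot (EdgeColoredGraph.unionProd (EdgeColoredGraph.cardPart k g)
    (EdgeColoredGraph.cardPart (Fintype.card V - k) g'))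
  rw [sum_unionProd] at e4 e5
  rw [e1, e2, e3] at e4
  linarith

/-- Convolutions of hypomorphic set functions agree at the whole vertex set if both factors do:
the splittings with an empty part only involve values at the whole and at the empty set. -/
lemma Hypomorphic.subsetConv_univ [Nonempty V] {σ : V → Equiv.Perm V} (hσ : ∀ v, σ v v = v)
    {f g f' g' : Finset V → ℚ} (h : Hypomorphic σ f g) (h' : Hypomorphic σ f' g')
    (hu : f univ = g univ) (hu' : f' univ = g' univ) :
    subsetConv f f' univ = subsetConv g g' univ := by
  have split : ∀ f f' : Finset V → ℚ, EdgeColoredGraph.subsetConv f f' univ =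
      f ∅ * f' univ + f univ * f' ∅ +
        ∑ T : Finset V with T ≠ ∅ ∧ T ≠ univ, f T * f' Tᶜ := by
    intro f f'
    unfold EdgeColoredGraph.subsetConv
    have hne : (∅ : Finset V) ≠ univ := (Finset.univ_nonempty).ne_empty.symm
    rw [Finset.powerset_univ,
      ← Finset.sum_filter_add_sum_filter_not univ (fun T : Finset V => T ≠ ∅ ∧ T ≠ univ), add_comm]
    congr 1
    have : univ.filter (fun T : Finset V => ¬ (T ≠ ∅ ∧ T ≠ univ)) = {∅, univ} := by
      ext T; simp; tauto
    rw [this, Finset.sum_pair hne]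
    simp
  obtain ⟨v⟩ := ‹Nonempty V›
  have h0 := h v ∅ (Finset.empty_subset _)
  have h0' := h' v ∅ (Finset.empty_subset _)
  rw [Finset.map_empty] at h0 h0'
  rw [split, split, h.sum_mul_compl hσ h', hu, hu', h0, h0']

end SetFunction

/-! ### Sums over maps from the vertices to a finite set -/

section PartSum

variable {V W : Type u} [DecidableEq V] [DecidableEq W] [Fintype V] [Fintype W]
  {ι : Type} [DecidableEq ι]

/-- The sum, over all maps `κ` from `S` to `I`, of the product of `h i` of the fibre over `i`.
A map on `S` is encoded as a map on all of `V` with the value `none` exactly off `S`. -/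
def partSum (h : ι → Finset V → ℚ) (I : Finset ι) (S : Finset V) : ℚ :=
  ∑ κ ∈ Fintype.piFinset (fun v : V => if v ∈ S then I.map .some else {none}),
    ∏ i ∈ I, h i {v | κ v = some i}

lemma partSum_empty (h : ι → Finset V → ℚ) (S : Finset V) :
    partSum h ∅ S = if S = ∅ then 1 else 0 := by
  unfold partSum
  split_ifs with hS
  · subst hS
    simp
  · obtain ⟨v, hv⟩ := Finset.nonempty_iff_ne_empty.2 hS
    rw [Finset.sum_eq_zero]
    intro κ hκ
    have := Fintype.mem_piFinset.1 hκ v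
    simp [hv] at this

lemma partSum_insert (h : ι → Finset V → ℚ) {I : Finset ι} {i : ι} (hi : i ∉ I) (S : Finset V) :
    partSum h (insert i I) S = subsetConv (h i) (partSum h I) S := by
  unfold partSum subsetConv
  simp_rw [Finset.mul_sum]
  rw [Finset.sum_sigma']
  refine Finset.sum_bij' (fun κ _ => ⟨({v | κ v = some i} : Finset V),
      fun v => if κ v = some i then none else κ v⟩)
    (fun p _ => fun v => if v ∈ p.1 then some i else p.2 v) ?_ ?_ ?_ ?_ ?_
  · intro κ hκ
    rw [Fintype.mem_piFinset] at hκ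
    simp only [mem_sigma, mem_powerset, Fintype.mem_piFinset]
    refine ⟨fun v hv => ?_, fun v => ?_⟩
    · have := hκ v
      simp only [mem_filter, mem_univ, true_and] at hv
      by_contra hS
      simp [hS, hv] at this
    · have := hκ v
      by_cases hS : v ∈ S <;> by_cases hv : κ v = some i <;> simp [hS, hv] at this ⊢
      · grind
      · exact this
  · rintro ⟨T, κ⟩ hp
    simp only [mem_sigma, mem_powerset, Fintype.mem_piFinset] at hp
    obtain ⟨hT, hκ⟩ := hp
    rw [Fintype.mem_piFinset]
    intro v
    have := hκ v
    by_cases hv : v ∈ T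
    · simp [hv, hT hv]
    · by_cases hS : v ∈ S
      · simp only [mem_sdiff, hS, hv, not_false_eq_true, and_self, if_true] at this
        simp only [hv, hS, if_true, if_false]
        exact Finset.map_subset_map.2 (Finset.subset_insert _ _) this
      · simp [hS, hv] at this ⊢
        exact this
  · intro κ hκ
    funext v
    by_cases hv : κ v = some i <;> simp [hv]
  · rintro ⟨T, κ⟩ hp
    simp only [mem_sigma, mem_powerset, Fintype.mem_piFinset] at hp
    obtain ⟨hT, hκ⟩ := hp
    have hne : ∀ v, κ v ≠ some i := by
      intro v hv
      have := hκ v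
      rw [hv] at this
      split_ifs at this <;> simp [hi] at this
    have hno : ∀ v ∈ T, κ v = none := by
      intro v hv
      have := hκ v
      simpa [hv] using this
    have e1 : (univ.filter fun v => (if v ∈ T then some i else κ v) = some i) = T := by
      ext v
      by_cases hv : v ∈ T <;> simp [hv, hne]
    have e2 : (fun v => if (if v ∈ T then some i else κ v) = some i then none
        else (if v ∈ T then some i else κ v)) = κ := by
      funext v
      by_cases hv : v ∈ T <;> simp [hv, hne, hno]
    simp only [e1, e2]
  · intro κ hκ
    rw [Finset.prod_insert hi]
    congr 1
    refine Finset.prod_congr rfl fun j hj => ?_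
    have hji : j ≠ i := fun e => hi (e ▸ hj)
    congr 1
    ext v
    by_cases hv : κ v = some i <;> simp [hv, hji.symm]

lemma partSum_univ [Fintype ι] (h : ι → Finset V → ℚ) :
    partSum h univ univ = ∑ κ : V → ι, ∏ i, h i {v | κ v = i} := by
  unfold partSum
  symm
  refine Finset.sum_bij (fun κ _ => fun v => some (κ v)) ?_ ?_ ?_ ?_
  · intro κ _
    simp [Fintype.mem_piFinset]
  · intro κ _ κ' _ e
    funext v
    simpa using congrFun e v
  · intro κ hκ
    simp only [Fintype.mem_piFinset, mem_univ, if_true, mem_map, true_and] at hκ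
    choose κ' hκ' using hκ
    exact ⟨κ', mem_univ _, funext hκ'⟩
  · intro κ _
    simp

lemma Agree.partSum {φ : V ≃ W} {U : Finset V} {h : ι → Finset V → ℚ} {h' : ι → Finset W → ℚ}
    (hh : ∀ i, Agree φ U (h i) (h' i)) (I : Finset ι) :
    Agree φ U (partSum h I) (partSum h' I) := by
  induction I using Finset.induction_on with
  | empty =>
    intro S _
    simp [partSum_empty]
  | insert i I hi ih =>
    intro S hS
    rw [partSum_insert h hi, partSum_insert h' hi]
    exact (hh i).subsetConv ih S hS

lemma Hypomorphic.partSum_univ [Nonempty V] {σ : V → Equiv.Perm V} (hσ : ∀ v, σ v v = v)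
    {h h' : ι → Finset V → ℚ} (hh : ∀ i, Hypomorphic σ (h i) (h' i))
    (hu : ∀ i, h i univ = h' i univ) (I : Finset ι) :
    partSum h I univ = partSum h' I univ := by
  induction I using Finset.induction_on with
  | empty => simp only [partSum_empty]
  | insert i I hi ih =>
    rw [partSum_insert h hi, partSum_insert h' hi]
    exact (hh i).subsetConv_univ hσ (fun v => Agree.partSum (fun j => hh j v) I) (hu i) ih

end PartSum

/-! ### Edge weights -/

section Weight

variable {V W : Type u}

/-- The generating function `∏ (1 + w e)` of all sets of edges inside `S`, for a weight function
`w` that vanishes off the edges. -/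
def edgeProd (w : Sym2 V → ℚ) (S : Finset V) : ℚ :=
  ∏ e ∈ S.sym2, (1 + w e)

lemma edgeProd_map {φ : V ≃ W} {S : Finset V} {w : Sym2 V → ℚ} {w' : Sym2 W → ℚ}
    (h : ∀ e ∈ S.sym2, w' (e.map φ) = w e) :
    edgeProd w' (S.map φ.toEmbedding) = edgeProd w S := by
  unfold edgeProd
  rw [Finset.sym2_map, Finset.prod_map]
  refine Finset.prod_congr rfl fun e he => ?_
  have := h e he
  simp only [Function.Embedding.sym2Map_apply, Equiv.coe_toEmbedding, this]

lemma edgeProd_pos {w : Sym2 V → ℚ} (hw : ∀ e, 0 ≤ w e) (S : Finset V) : 0 < edgeProd w S :=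
  Finset.prod_pos fun e _ => by linarith [hw e]

/-- Every edge survives the deletion of any vertex other than its two ends. -/
lemma prod_edgeProd_compl [Fintype V] [DecidableEq V] {w : Sym2 V → ℚ}
    (hd : ∀ e, e.IsDiag → w e = 0) :
    ∏ v : V, edgeProd w {v}ᶜ = edgeProd w univ ^ (Fintype.card V - 2) := by
  unfold edgeProd
  rw [Finset.prod_comm' (t' := (univ : Finset V).sym2) (s' := fun e => e.toFinsetᶜ)]
  · rw [← Finset.prod_pow]
    refine Finset.prod_congr rfl fun e _ => ?_
    rw [Finset.prod_const, Finset.card_compl, Sym2.card_toFinset]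
    -- A diagonal pair has one end only, but contributes the factor `1`.
    split_ifs with he
    · simp [hd e he]
    · rfl
  · intro v e
    simp only [mem_univ, true_and, mem_sym2_iff, mem_compl, mem_singleton, Sym2.mem_toFinset,
      implies_true, and_true]
    exact ⟨fun h hv => h v hv rfl, fun h a ha e => h (e ▸ ha)⟩

/-- The number of edges of each color is reconstructible, in multiplicative form: a positive number
is determined by its power with the exponent `|V| - 2 > 0`. -/
lemma edgeProd_univ_eq [Fintype V] [DecidableEq V] (hV : 3 ≤ Fintype.card V)
    {σ : V → Equiv.Perm V} (hσ : ∀ v, σ v v = v) {w w' : Sym2 V → ℚ}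
    (hw : ∀ e, 0 ≤ w e) (hw' : ∀ e, 0 ≤ w' e)
    (hd : ∀ e, e.IsDiag → w e = 0) (hd' : ∀ e, e.IsDiag → w' e = 0)
    (h : ∀ v e, v ∉ e → w' (e.map (σ v)) = w e) :
    edgeProd w univ = edgeProd w' univ := by
  refine (pow_left_inj₀ (edgeProd_pos hw _).le (edgeProd_pos hw' _).le
    (n := Fintype.card V - 2) (by omega)).1 ?_
  rw [← prod_edgeProd_compl hd, ← prod_edgeProd_compl hd']
  refine Finset.prod_congr rfl fun v _ => ?_
  have hv : ({v}ᶜ : Finset V).map (σ v).toEmbedding = {v}ᶜ := by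
    ext x
    have : (σ v).symm x = v ↔ x = v := by rw [Equiv.symm_apply_eq, hσ]
    simp [Finset.mem_map_equiv, this]
  rw [← edgeProd_map (φ := σ v) (w' := w'), hv]
  intro e he
  refine h v e fun hve => ?_
  simpa using Finset.mem_sym2_iff.1 he v hve

/-- The sum over all maps `κ` from the vertices to `ι` of the weights `z` of the values, times
the generating function of the sets of edges along which `κ` is constant. -/
noncomputable def mapSum [Fintype V] {ι : Type} [Fintype ι] (w : Sym2 V → ℚ) (z : ι → ℚ) : ℚ :=
  open Classical in
  ∑ κ : V → ι, ∏ i, (z i ^ #{v | κ v = i} * edgeProd w {v | κ v = i})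

lemma mapSum_eq_partSum [Fintype V] [DecidableEq V] {ι : Type} [Fintype ι] [DecidableEq ι]
    (w : Sym2 V → ℚ) (z : ι → ℚ) :
    mapSum w z = partSum (fun i S => z i ^ #S * edgeProd w S) univ univ := by
  rw [EdgeColoredGraph.partSum_univ, mapSum]
  refine Finset.sum_congr (by congr!) fun κ _ => Finset.prod_congr rfl fun i _ => ?_
  congr!

lemma agree_edgeProd {φ : V ≃ W} {U : Finset V} {w : Sym2 V → ℚ} {w' : Sym2 W → ℚ}
    (h : ∀ e ∈ U.sym2, w' (e.map φ) = w e) (c : ℚ) :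
    Agree φ U (fun S => c ^ #S * edgeProd w S) (fun S => c ^ #S * edgeProd w' S) := by
  intro S hS
  simp only [Finset.card_map]
  rw [edgeProd_map fun e he => h e (Finset.sym2_mono hS he)]

lemma mapSum_eq_of_equiv [Fintype V] [Fintype W] {ι : Type} [Fintype ι] (φ : V ≃ W)
    {w : Sym2 V → ℚ} {w' : Sym2 W → ℚ} (h : ∀ e, w' (e.map φ) = w e) (z : ι → ℚ) :
    mapSum w z = mapSum w' z := by
  classical
  rw [mapSum_eq_partSum, mapSum_eq_partSum]
  have := Agree.partSum (fun i => agree_edgeProd (U := univ) (fun e _ => h e) (z i)) univ univ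
    subset_rfl
  rw [← this, Finset.map_univ_equiv]

lemma mapSum_eq_of_hypomorphic [Fintype V] (hV : 3 ≤ Fintype.card V)
    {σ : V → Equiv.Perm V} (hσ : ∀ v, σ v v = v) {w w' : Sym2 V → ℚ}
    (hw : ∀ e, 0 ≤ w e) (hw' : ∀ e, 0 ≤ w' e)
    (hd : ∀ e, e.IsDiag → w e = 0) (hd' : ∀ e, e.IsDiag → w' e = 0)
    (h : ∀ v e, v ∉ e → w' (e.map (σ v)) = w e) {ι : Type} [Fintype ι] (z : ι → ℚ) :
    mapSum w z = mapSum w' z := by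
  classical
  have : Nonempty V := Fintype.card_pos_iff.1 (by omega)
  rw [mapSum_eq_partSum, mapSum_eq_partSum]
  refine Hypomorphic.partSum_univ hσ (fun i v => agree_edgeProd (fun e he => h v e fun hve => ?_) _)
    (fun i => ?_) univ
  · simpa using Finset.mem_sym2_iff.1 he v hve
  · rw [edgeProd_univ_eq hV hσ hw hw' hd hd' h]

end Weight

/-! ### The colored `U`-polynomial at power sums -/

section Eval

variable {V W : Type u} {C : Type}

open Classical in
/-- The weight of a pair of vertices: the value of `y` at the color of the edge, or zero off the
edges. -/
noncomputable def weight (G : EdgeColoredGraph V C) (y : C → ℚ) (e : Sym2 V) : ℚ :=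
  if h : e ∈ G.graph.edgeSet then y (G.color ⟨e, h⟩) else 0

lemma weight_nonneg (G : EdgeColoredGraph V C) {y : C → ℚ} (hy : ∀ c, 0 ≤ y c) (e : Sym2 V) :
    0 ≤ G.weight y e := by
  unfold weight
  split_ifs
  · exact hy _
  · rfl

lemma weight_isDiag (G : EdgeColoredGraph V C) (y : C → ℚ) (e : Sym2 V) (he : e.IsDiag) :
    G.weight y e = 0 :=
  dif_neg fun h => G.graph.not_isDiag_of_mem_edgeSet h he

lemma weight_induce (G : EdgeColoredGraph V C) (s : Set V) (y : C → ℚ) (e : Sym2 s) :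
    (G.induce s).weight y e = G.weight y (e.map Subtype.val) := by
  have hiff : e ∈ (G.induce s).graph.edgeSet ↔ e.map Subtype.val ∈ G.graph.edgeSet := by
    induction e with | _ a b => rfl
  by_cases h : e ∈ (G.induce s).graph.edgeSet
  · rw [weight, dif_pos h, weight, dif_pos (hiff.1 h)]
    rfl
  · rw [weight, dif_neg h, weight, dif_neg (fun h' => h (hiff.2 h'))]

lemma IsIsomorphic.exists_weight {G : EdgeColoredGraph V C} {H : EdgeColoredGraph W C}
    (h : G.IsIsomorphic H) :
    ∃ φ : V ≃ W, ∀ y e, H.weight y (e.map φ) = G.weight y e := by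
  obtain ⟨φ, hφ⟩ := h
  refine ⟨φ.toEquiv, fun y e => ?_⟩
  have hiff : e.map φ.toEquiv ∈ H.graph.edgeSet ↔ e ∈ G.graph.edgeSet := by
    induction e with | _ a b => exact φ.map_rel_iff
  by_cases h : e ∈ G.graph.edgeSet
  · rw [weight, dif_pos (hiff.2 h), weight, dif_pos h, ← hφ ⟨e, h⟩]
    rfl
  · rw [weight, dif_neg (fun h' => h (hiff.1 h')), weight, dif_neg h]

/-- The isomorphisms between the vertex-deleted subgraphs, extended to permutations of the whole
vertex set that fix the deleted vertex. -/
lemma IsReconstruction.exists_weight {G H : EdgeColoredGraph V C} (h : G.IsReconstruction H) :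
    ∃ σ : V → Equiv.Perm V, (∀ v, σ v v = v) ∧
      ∀ y v e, v ∉ e → H.weight y (e.map (σ v)) = G.weight y e := by
  classical
  choose φ hφ using fun v => (h v).exists_weight
  refine ⟨fun v => Equiv.Perm.ofSubtype (p := (· ∈ ({v}ᶜ : Set V))) (φ v), fun v => ?_,
    fun y v e hv => ?_⟩
  · exact Equiv.Perm.ofSubtype_apply_of_not_mem _ (by simp)
  · have he : ∃ e' : Sym2 ({v}ᶜ : Set V), e'.map Subtype.val = e := by
      induction e with | _ a b =>
      simp only [Sym2.mem_iff, not_or] at hv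
      exact ⟨s(⟨a, fun e => hv.1 e.symm⟩, ⟨b, fun e => hv.2 e.symm⟩), rfl⟩
    obtain ⟨e', rfl⟩ := he
    have := hφ v y e'
    unfold deleteVertex at this
    rw [weight_induce, weight_induce] at this
    rw [← this, Sym2.map_map, Sym2.map_map]
    congr 2
    funext x
    exact Equiv.Perm.ofSubtype_apply_coe (p := (· ∈ ({v}ᶜ : Set V))) (φ v) x

open Classical in
/-- The product of power sums over the components is the sum over the maps that are constant on
every component. -/
lemma prod_component_powerSum [Fintype V] {ι : Type} [Fintype ι] (K : SimpleGraph V) (z : ι → ℚ) :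
    ∏ D : K.ConnectedComponent, ∑ i, z i ^ D.supp.ncard =
      ∑ κ : V → ι with ∀ a b, K.Adj a b → κ a = κ b, ∏ v, z (κ v) := by
  rw [Finset.prod_univ_sum, Fintype.piFinset_univ]
  refine Finset.sum_bij (fun g _ => fun v => g (K.connectedComponentMk v)) ?_ ?_ ?_ ?_
  · intro g _
    simp only [mem_filter, mem_univ, true_and]
    intro a b hab
    rw [SimpleGraph.ConnectedComponent.eq.2 hab.reachable]
  · intro g _ g' _ e
    funext D
    induction D using SimpleGraph.ConnectedComponent.ind with | _ v => exact congrFun e v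
  · intro κ hκ
    simp only [mem_filter, mem_univ, true_and] at hκ
    refine ⟨fun D => D.lift κ ?_, mem_univ _, rfl⟩
    intro v w p _
    induction p with
    | nil => rfl
    | cons hab p ih =>
      rename_i hp
      exact (hκ _ _ hab).trans (ih (SimpleGraph.Walk.IsPath.of_cons hp))
  · intro g _
    rw [← Finset.prod_fiberwise univ (fun v => K.connectedComponentMk v)]
    refine Finset.prod_congr rfl fun D _ => ?_
    rw [Finset.prod_congr rfl (g := fun _ => z (g D)), Finset.prod_const]
    · congr 1
      rw [← Set.ncard_coe_finset]
      congr 1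
      ext v
      simp [SimpleGraph.ConnectedComponent.mem_supp_iff]
    · intro v hv
      exact congrArg (fun D => z (g D)) (Finset.mem_filter.1 hv).2

lemma spanningSubgraph_const_iff (G : EdgeColoredGraph V C) (A : Set G.graph.edgeSet) {ι : Type}
    (κ : V → ι) :
    (∀ a b, (G.spanningSubgraph A).Adj a b → κ a = κ b) ↔
      ∀ e ∈ A, ∃ i, ∀ v ∈ (e : Sym2 V), κ v = i := by
  constructor
  · rintro h ⟨e, he⟩ heA
    induction e with | _ a b =>
    have hab : (G.spanningSubgraph A).Adj a b := by
      rw [spanningSubgraph, SimpleGraph.fromEdgeSet_adj]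
      exact ⟨⟨_, heA, rfl⟩, G.graph.ne_of_adj he⟩
    refine ⟨κ a, fun v hv => ?_⟩
    rcases Sym2.mem_iff.1 hv with rfl | rfl
    · rfl
    · exact (h _ _ hab).symm
  · intro h a b hab
    rw [spanningSubgraph, SimpleGraph.fromEdgeSet_adj] at hab
    obtain ⟨⟨e, he, hab⟩, -⟩ := hab
    obtain ⟨i, hi⟩ := h e he
    simp only at hab
    rw [hi a (by simp [hab]), hi b (by simp [hab])]

open Classical in
/-- An edge along which `κ` is constant lies inside exactly one fibre of `κ`. -/
lemma prod_mono_eq [Fintype V] (G : EdgeColoredGraph V C) (y : C → ℚ) {ι : Type} [Fintype ι]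
    (κ : V → ι) :
    ∏ e ∈ (univ : Finset G.graph.edgeSet).filter
        (fun e : G.graph.edgeSet => ∃ i, ∀ v ∈ (e : Sym2 V), κ v = i), (1 + y (G.color e)) =
      ∏ i, edgeProd (G.weight y) {v | κ v = i} := by
  have e1 : ∏ i, edgeProd (G.weight y) {v | κ v = i} =
      ∏ e : Sym2 V with ∃ i, ∀ v ∈ e, κ v = i, (1 + G.weight y e) := by
    unfold edgeProd
    rw [← Finset.prod_biUnion]
    · refine Finset.prod_congr ?_ fun _ _ => rfl
      ext e
      simp [Finset.mem_sym2_iff]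
    · intro i _ j _ hij
      refine Finset.disjoint_left.2 fun e hi hj => hij ?_
      rw [Finset.mem_sym2_iff] at hi hj
      have h1 := hi _ (Sym2.out_fst_mem e)
      have h2 := hj _ (Sym2.out_fst_mem e)
      simp only [mem_filter, mem_univ, true_and] at h1 h2
      exact h1.symm.trans h2
  rw [e1, ← Finset.prod_filter_mul_prod_filter_not _ (fun e => e ∈ G.graph.edgeSet),
    Finset.prod_eq_one (s := Finset.filter (fun e => ¬ e ∈ G.graph.edgeSet) _), mul_one]
  · refine Finset.prod_bij (fun e _ => (e : Sym2 V)) ?_ ?_ ?_ ?_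
    · intro e he
      simpa using he
    · intro e _ e' _ h
      exact Subtype.ext h
    · intro e he
      simp only [mem_filter, mem_univ, true_and] at he
      exact ⟨⟨e, he.2⟩, by simpa using he.1, rfl⟩
    · intro e _
      rw [weight, dif_pos e.2]
  · intro e he
    rw [weight, dif_neg (Finset.mem_filter.1 he).2, add_zero]

lemma eval_Ulab [Fintype V] (G : EdgeColoredGraph V C) (x : ℕ → ℚ) (y : C → ℚ) :
    open Classical in
    MvPolynomial.eval₂ (Int.castRingHom ℚ) (Sum.elim x y) G.Ulab =
      ∑ A : Finset G.graph.edgeSet, (∏ e ∈ A, y (G.color e)) *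
        ∏ D : (G.spanningSubgraph (A : Set G.graph.edgeSet)).ConnectedComponent,
          x D.supp.ncard := by
  simp [Ulab, MvPolynomial.eval₂_sum, MvPolynomial.eval₂_mul, MvPolynomial.eval₂_prod]

/-- At power sums, the colored `U`-polynomial is a sum over maps from the vertices, in which
connected components no longer occur. -/
lemma eval_Ulab_powerSum [Fintype V] (G : EdgeColoredGraph V C) (y : C → ℚ) {ι : Type} [Fintype ι]
    (z : ι → ℚ) :
    MvPolynomial.eval₂ (Int.castRingHom ℚ) (Sum.elim (fun k => ∑ i, z i ^ k) y) G.Ulab =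
      mapSum (G.weight y) z := by
  classical
  rw [eval_Ulab]
  simp_rw [prod_component_powerSum, spanningSubgraph_const_iff, Finset.mul_sum, Finset.sum_filter]
  rw [Finset.sum_comm, mapSum]
  refine Finset.sum_congr (by congr!) fun κ _ => ?_
  rw [Finset.prod_mul_distrib]
  have e1 : ∏ i, z i ^ #{v | κ v = i} = ∏ v, z (κ v) := by
    rw [← Finset.prod_fiberwise univ κ]
    refine Finset.prod_congr rfl fun i _ => ?_
    rw [Finset.prod_congr rfl (g := fun _ => z i), Finset.prod_const]
    intro v hv
    rw [(Finset.mem_filter.1 hv).2]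
  have e2 := prod_mono_eq G y κ
  rw [Finset.prod_one_add] at e2
  rw [← Finset.sum_filter, ← Finset.sum_mul, mul_comm]
  congr 1
  · exact e1.symm
  · convert e2 using 1
    refine Finset.sum_congr ?_ fun _ _ => rfl
    ext A
    simp [Finset.subset_iff]

end Eval

/-! ### Density of power sums -/

section Density

variable {V W : Type u} {C : Type}

/-- Rational numbers `x_0, …, x_n` are power sums of `0, …, n` taken with suitable rational
multiplicities. -/
lemma exists_multiplicities (n : ℕ) (x : ℕ → ℚ) :
    ∃ m : Fin (n + 1) → ℚ, ∀ k ≤ n, ∑ i, m i * (i : ℚ) ^ k = x k := by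
  have hinj : Function.Injective (fun i : Fin (n + 1) => (i : ℚ)) := fun i j h => by
    exact Fin.ext (Nat.cast_injective h)
  have hdet := isUnit_iff_ne_zero.2 (Matrix.det_vandermonde_ne_zero_iff.2 hinj)
  set M := Matrix.vandermonde (fun i : Fin (n + 1) => (i : ℚ))
  refine ⟨Matrix.vecMul (fun k : Fin (n + 1) => x k) M⁻¹, fun k hk => ?_⟩
  have h : Matrix.vecMul (Matrix.vecMul (fun k : Fin (n + 1) => x k) M⁻¹) M =
      fun k : Fin (n + 1) => x k := by
    rw [Matrix.vecMul_vecMul, Matrix.nonsing_inv_mul _ hdet, Matrix.vecMul_one]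
  exact congrFun h ⟨k, Nat.lt_succ_of_le hk⟩

/-- Two colored `U`-polynomials are equal as soon as they agree at all nonnegative `y` and all
power sums. -/
lemma Ulab_eq_of_mapSum_eq [Fintype V] [Fintype W] {G : EdgeColoredGraph V C}
    {H : EdgeColoredGraph W C}
    (h : ∀ y : C → ℚ, (∀ c, 0 ≤ y c) → ∀ (ι : Type) [Fintype ι] (z : ι → ℚ),
      mapSum (G.weight y) z = mapSum (H.weight y) z) :
    G.Ulab = H.Ulab := by
  classical
  apply MvPolynomial.map_injective (Int.castRingHom ℚ) Int.cast_injective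
  apply MvPolynomial.funext
  intro p
  obtain ⟨x, y, rfl⟩ : ∃ x y, p = Sum.elim x y := ⟨p ∘ Sum.inl, p ∘ Sum.inr, by simp⟩
  rw [MvPolynomial.eval_map, MvPolynomial.eval_map]
  let n := max (Fintype.card V) (Fintype.card W)
  -- The polynomials in the multiplicities `X (inl i)` and in the `y`-variables that arise from
  -- `Ulab` when the power sums of `0, …, n` with these multiplicities are substituted for `x`.
  let s : ℕ ⊕ C → MvPolynomial (Fin (n + 1) ⊕ C) ℚ := Sum.elim
    (fun k => ∑ i : Fin (n + 1), MvPolynomial.X (Sum.inl i) * MvPolynomial.C ((i : ℚ) ^ k))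
    (fun c => MvPolynomial.X (Sum.inr c))
  have heval : ∀ (P : MvPolynomial (ℕ ⊕ C) ℤ) (q : Fin (n + 1) ⊕ C → ℚ),
      MvPolynomial.eval q
        (MvPolynomial.eval₂ ((MvPolynomial.C).comp (Int.castRingHom ℚ)) s P) =
      MvPolynomial.eval₂ (Int.castRingHom ℚ)
        (Sum.elim (fun k => ∑ i, q (Sum.inl i) * (i : ℚ) ^ k) (q ∘ Sum.inr)) P := by
    intro P q
    rw [MvPolynomial.hom_eval₂]
    congr 1
    · exact Subsingleton.elim _ _
    · funext j
      rcases j with k | c <;> simp [s]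
  have hpoly : MvPolynomial.eval₂ ((MvPolynomial.C).comp (Int.castRingHom ℚ)) s G.Ulab =
      MvPolynomial.eval₂ ((MvPolynomial.C).comp (Int.castRingHom ℚ)) s H.Ulab := by
    refine MvPolynomial.funext_set (fun _ => Set.range ((↑) : ℕ → ℚ))
      (fun _ => Set.infinite_range_of_injective Nat.cast_injective) fun q hq => ?_
    choose m hm using fun j => hq j (Set.mem_univ j)
    rw [heval, heval]
    -- Natural multiplicities `m` are realized by repeating `i` exactly `m i` times.
    have hx : (fun k => ∑ i : Fin (n + 1), q (Sum.inl i) * (i : ℚ) ^ k) =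
        fun k => ∑ j : (i : Fin (n + 1)) × Fin (m (Sum.inl i)), ((j.1 : ℕ) : ℚ) ^ k := by
      funext k
      rw [Fintype.sum_sigma]
      simp [← hm]
    rw [hx, eval_Ulab_powerSum, eval_Ulab_powerSum]
    refine h _ (fun c => ?_) _ _
    simp [← hm]
  -- Only `x_k` with `k ≤ n` occur, since a component has at most `n` vertices.
  obtain ⟨m, hm⟩ := exists_multiplicities n x
  have hred : ∀ {U : Type u} [Fintype U] (K : EdgeColoredGraph U C), Fintype.card U ≤ n →
      MvPolynomial.eval₂ (Int.castRingHom ℚ) (Sum.elim x y) K.Ulab =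
      MvPolynomial.eval₂ (Int.castRingHom ℚ)
        (Sum.elim (fun k => ∑ i, m i * (i : ℚ) ^ k) y) K.Ulab := by
    intro U _ K hU
    rw [eval_Ulab, eval_Ulab]
    refine Finset.sum_congr rfl fun A _ => ?_
    congr 1
    refine Finset.prod_congr rfl fun D _ => (hm _ (le_trans ?_ hU)).symm
    rw [← Nat.card_eq_fintype_card]
    exact Set.ncard_le_card _
  rw [hred G (le_max_left _ _), hred H (le_max_right _ _)]
  have := congrArg (MvPolynomial.eval (Sum.elim m y)) hpoly
  rw [heval, heval] at this
  simpa using this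

end Density

end EdgeColoredGraph

theorem mainTheorem2 (Λ : ℕ) :
    EdgeColoredGraph.IsReconstructible.{u}
      (fun (V : Type u) [Fintype V] (G : EdgeColoredGraph V (Fin Λ)) => G.Ulab) := by
  refine ⟨fun V W _ _ G H h => ?_, fun V _ hV G H h => ?_⟩
  · obtain ⟨φ, hφ⟩ := h.exists_weight
    exact EdgeColoredGraph.Ulab_eq_of_mapSum_eq fun y _ ι _ z =>
      EdgeColoredGraph.mapSum_eq_of_equiv φ (hφ y) z
  · obtain ⟨σ, hσ, hσw⟩ := h.exists_weight
    exact EdgeColoredGraph.Ulab_eq_of_mapSum_eq fun y hy ι _ z =>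
      EdgeColoredGraph.mapSum_eq_of_hypomorphic hV hσ (G.weight_nonneg hy) (H.weight_nonneg hy)
        (G.weight_isDiag y) (H.weight_isDiag y) (hσw y) z
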